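/- A (Kripke) frame is a pair $(W,R)$ with $W\neq\varnothing$ and $R\subseteq W\times W$; $R^0$ is the identity relation, $R^{i+1}=R^i\circ R$, and $R^*=\bigcup_{i\ge 0}R^i$. The skeleton of $(W,R)$ is the set of equivalence classes of the relation ``$xR^*y$ and $yR^*x$'', partially ordered by $[x]\le[y]\iff xR^*y$. The frame has height $k\in\mathbb N$ if its skeleton has a chain of cardinality $k$ and no chain of larger cardinality; it has finite height if it has height $k$ for some $k\in\mathbb N$. Let $\mathcal F(m,n,h)$ be the class of all frames with $R^n\subseteq R^m$ of height at most $h$, and let $\mathcal F_*(m,n)$ be the class of all frames with $R^n\subseteq R^m$ of finite height. Let $\mathcal G(m,h)$ be the class of all $m$-transitive frames (frames with $R^*=\bigcup_{i\le m}R^i$) of height at most $h$, and let $\mathcal G_*(m)$ be the class of all $m$-transitive frames of finite height. Bimodal formulas are built from countably many propositional variables, Boolean connectives and two unary modalities $\Diamond_1,\Diamond_2$, and are interpreted in frames $(W,R_1,R_2)$, $W\ne\varnothing$, with $\Diamond_i\varphi$ true at $w$ iff $\varphi$ is true at some $v$ with $wR_iv$. The logic of a class of such frames is the set of all bimodal formulas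 that are true at every point under every valuation in every frame of the class. A bimodal logic has the finite model property if it is the logic of some class of finite frames $(W,R_1,R_2)$. For a class $\mathcal C$ of frames $(W,R)$, put $\mathcal C^{t}=\{(W,R,R^{-1})\mid (W,R)\in\mathcal C\}$. \textbf{Corollary.} Let $n>m\ge 1$ and $h\ge 1$. Then the logics of the classes $\mathcal F(m,n,h)^{t}$, $\mathcal F_*(m,n)^{t}$, $\mathcal G(m,h)^{t}$ and $\mathcal G_*(m)^{t}$ have the finite model property. -/

import Mathlib

universe u

namespace KModal

/-- Modal formulas with `k` diamonds over the countable set of variables `p 0, p 1, …`. -/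
inductive Formula (k : ℕ) : Type
  | var (p : ℕ) : Formula k
  | bot : Formula k
  | top : Formula k
  | and (φ ψ : Formula k) : Formula k
  | or (φ ψ : Formula k) : Formula k
  | neg (φ : Formula k) : Formula k
  | imp (φ ψ : Formula k) : Formula k
  | iff (φ ψ : Formula k) : Formula k
  | dia (i : Fin k) (φ : Formula k) : Formula k

/-- Kripke frames with `k` relations. -/
structure MultiFrame (k : ℕ) : Type (u + 1) where
  W : Type u
  nonempty : Nonempty W
  R : Fin k → W → W → Prop

/-- Truth of a formula at a point of the model given by a frame and a valuation `θ`. -/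
def MultiFrame.Sat {k : ℕ} (F : MultiFrame.{u} k) (θ : ℕ → Set F.W) : F.W → Formula k → Prop
  | w, .var p => w ∈ θ p
  | _, .bot => False
  | _, .top => True
  | w, .and φ ψ => F.Sat θ w φ ∧ F.Sat θ w ψ
  | w, .or φ ψ => F.Sat θ w φ ∨ F.Sat θ w ψ
  | w, .neg φ => ¬ F.Sat θ w φ
  | w, .imp φ ψ => F.Sat θ w φ → F.Sat θ w ψ
  | w, .iff φ ψ => F.Sat θ w φ ↔ F.Sat θ w ψ
  | w, .dia i φ => ∃ v, F.R i w v ∧ F.Sat θ v φ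

/-- Validity of a formula in a frame. -/
def MultiFrame.Valid {k : ℕ} (F : MultiFrame.{u} k) (φ : Formula k) : Prop :=
  ∀ (θ : ℕ → Set F.W) (w : F.W), F.Sat θ w φ

/-- The logic of a class of frames: all formulas valid in every frame of the class. -/
def Log {k : ℕ} (C : Set (MultiFrame.{u} k)) : Set (Formula k) :=
  {φ | ∀ F ∈ C, F.Valid φ}

/-- The finite model property: being the logic of some class of finite frames.
(Finite frames are taken in `Type`; every finite frame is isomorphic to one of these.) -/
def HasFMP {k : ℕ} (L : Set (Formula k)) : Prop :=
  ∃ C : Set (MultiFrame.{0} k), (∀ F ∈ C, Finite F.W) ∧ L = Log C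

/-- Kripke frames `(W, R)` with one relation. -/
structure KFrame : Type (u + 1) where
  W : Type u
  nonempty : Nonempty W
  R : W → W → Prop

/-- The `i`-fold composition of a relation with itself; the `0`-th power is equality. -/
def relPow {W : Type u} (R : W → W → Prop) : ℕ → W → W → Prop
  | 0 => Eq
  | i + 1 => Relation.Comp (relPow R i) R

namespace KFrame

/-- `R ^ n ⊆ R ^ m`. -/
def IsMN (m n : ℕ) (F : KFrame.{u}) : Prop :=
  ∀ x y, relPow F.R n x y → relPow F.R m x y

/-- `m`-transitivity: the reflexive transitive closure of `R` is `⋃ i ≤ m, R ^ i`. -/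
def IsMTransitive (m : ℕ) (F : KFrame.{u}) : Prop :=
  ∀ x y, Relation.ReflTransGen F.R x y ↔ ∃ i ≤ m, relPow F.R i x y

/-- Mutual reachability; its classes are the clusters of the frame. -/
def clusterSetoid (F : KFrame.{u}) : Setoid F.W where
  r x y := Relation.ReflTransGen F.R x y ∧ Relation.ReflTransGen F.R y x
  iseqv :=
    { refl := fun _ => ⟨.refl, .refl⟩
      symm := fun h => ⟨h.2, h.1⟩
      trans := fun h₁ h₂ => ⟨h₁.1.trans h₂.1, h₂.2.trans h₁.2⟩ }

/-- The set of clusters. -/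
def Skeleton (F : KFrame.{u}) : Type u := Quotient F.clusterSetoid

/-- The skeleton, ordered by reachability. -/
instance (F : KFrame.{u}) : PartialOrder F.Skeleton where
  le := Quotient.lift₂ (fun x y => Relation.ReflTransGen F.R x y)
    (fun _ _ _ _ h₁ h₂ => propext
      ⟨fun h => (h₁.2.trans h).trans h₂.1, fun h => (h₁.1.trans h).trans h₂.2⟩)
  le_refl := by rintro ⟨x⟩; exact Relation.ReflTransGen.refl
  le_trans := by rintro ⟨x⟩ ⟨y⟩ ⟨z⟩ h₁ h₂; exact Relation.ReflTransGen.trans h₁ h₂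
  le_antisymm := by rintro ⟨x⟩ ⟨y⟩ h₁ h₂; exact Quotient.sound ⟨h₁, h₂⟩

/-- The frame has height exactly `h`: its skeleton has a chain of cardinality `h` and no chain of
larger cardinality. -/
def HasHeight (F : KFrame.{u}) (h : ℕ) : Prop :=
  (∃ c : Set F.Skeleton, IsChain (· ≤ ·) c ∧ c.encard = h) ∧
    ∀ c : Set F.Skeleton, IsChain (· ≤ ·) c → c.encard ≤ h

/-- The bimodal frame `(W, R, R⁻¹)`. -/
def tense (F : KFrame.{u}) : MultiFrame.{u} 2 where
  W := F.W
  nonempty := F.nonempty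
  R := ![F.R, fun x y => F.R y x]

end KFrame

/-- `(m, n)`-frames of height at most `h`. -/
def classF (m n h : ℕ) : Set KFrame.{u} := {F | F.IsMN m n ∧ ∃ k ≤ h, F.HasHeight k}

/-- `(m, n)`-frames of finite height. -/
def classFStar (m n : ℕ) : Set KFrame.{u} := {F | F.IsMN m n ∧ ∃ k, F.HasHeight k}

/-- `m`-transitive frames of height at most `h`. -/
def classG (m h : ℕ) : Set KFrame.{u} := {F | F.IsMTransitive m ∧ ∃ k ≤ h, F.HasHeight k}

/-- `m`-transitive frames of finite height. -/
def classGStar (m : ℕ) : Set KFrame.{u} := {F | F.IsMTransitive m ∧ ∃ k, F.HasHeight k}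

/-- The class of all `(W, R, R⁻¹)` with `(W, R)` in the given class. -/
def tenseClass (C : Set KFrame.{u}) : Set (MultiFrame.{u} 2) := KFrame.tense '' C

end KModal

/-! Each class is closed under suitably chosen finite minimal filtrations. Inverting the relation
commutes with minimal filtration, so the truth lemma `exists_coloring` covers both modalities: a map
suffices once it separates finitely many colours.

The class condition survives if the map is tuned for the relation "some nonempty path has length 1
modulo `q`". A path of length `l` in the filtration then lifts to one of length `N ≥ l`, `N ≡ l`
modulo `q`. With `q = n - m`, a lift of an `n`-path shortens to length `m`; with `q = 1`, only
reachability matters.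

Finite height supplies the tuned map (`exists_tuned_refinement`), by induction on a rank that is
constant on clusters. Inside a cluster, paths reverse modulo `q`, so the types reachable with each
residue are the same for all points up to a shift, and recording them is finite data. -/

namespace KModal

/-! ### Path lengths modulo `q`, ranks and tuned refinements. -/

section Relations

variable {W : Type u} {R : W → W → Prop}

theorem relPow_add {a b : ℕ} {x y z : W} (h₁ : relPow R a x y) (h₂ : relPow R b y z) :
    relPow R (a + b) x z := by
  induction b generalizing z with
  | zero => exact (show y = z from h₂) ▸ h₁
  | succ b ih =>
    obtain ⟨w, hw, hwz⟩ := h₂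
    exact ⟨w, ih hw, hwz⟩

theorem relPow_one {x y : W} : relPow R 1 x y ↔ R x y :=
  ⟨fun ⟨_, h, h'⟩ => (show x = _ from h) ▸ h', fun h => ⟨x, rfl, h⟩⟩

theorem exists_of_relPow_add {a b : ℕ} {x z : W} (h : relPow R (a + b) x z) :
    ∃ y, relPow R a x y ∧ relPow R b y z := by
  induction b generalizing z with
  | zero => exact ⟨z, h, rfl⟩
  | succ b ih =>
    obtain ⟨w, hw, hwz⟩ := h
    obtain ⟨y, hy, hyw⟩ := ih hw
    exact ⟨y, hy, w, hyw, hwz⟩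

theorem relPow_mul_self {a : ℕ} {x : W} (h : relPow R a x x) (t : ℕ) : relPow R (t * a) x x := by
  induction t with
  | zero => rw [Nat.zero_mul]; exact rfl
  | succ t ih => rw [Nat.succ_mul]; exact relPow_add ih h

theorem reflTransGen_of_relPow {a : ℕ} {x y : W} (h : relPow R a x y) :
    Relation.ReflTransGen R x y := by
  induction a generalizing y with
  | zero => exact (show x = y from h) ▸ .refl
  | succ a ih =>
    obtain ⟨w, hw, hwy⟩ := h
    exact (ih hw).tail hwy

theorem exists_relPow {x y : W} (h : Relation.ReflTransGen R x y) : ∃ a, relPow R a x y := by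
  induction h with
  | refl => exact ⟨0, rfl⟩
  | tail _ h ih =>
    obtain ⟨a, ha⟩ := ih
    exact ⟨a + 1, _, ha, h⟩

theorem relPow_map {V : Type u} {Q : V → V → Prop} (f : W → V) (hf : ∀ x y, R x y → Q (f x) (f y))
    {a : ℕ} {x y : W} (h : relPow R a x y) : relPow Q a (f x) (f y) := by
  induction a generalizing y with
  | zero => exact congrArg f h
  | succ a ih =>
    obtain ⟨w, hw, hwy⟩ := h
    exact ⟨f w, ih hw, hf _ _ hwy⟩

/-- If `R ^ (m + q) ⊆ R ^ m`, then `R ^ (m + t * q) ⊆ R ^ m`. -/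
theorem relPow_reduce {m q : ℕ} (hR : ∀ x y, relPow R (m + q) x y → relPow R m x y) (t : ℕ)
    {x y : W} (h : relPow R (m + t * q) x y) : relPow R m x y := by
  induction t generalizing y with
  | zero => simpa using h
  | succ t ih =>
    rw [Nat.succ_mul, ← Nat.add_assoc] at h
    obtain ⟨z, hz, hzy⟩ := exists_of_relPow_add h
    exact hR _ _ (relPow_add (ih hz) hzy)

/-- There is a nonempty path from `x` to `y` whose length is `i` modulo `q`. -/
def ModPath (R : W → W → Prop) (q : ℕ) (i : ZMod q) (x y : W) : Prop :=
  ∃ N : ℕ, 1 ≤ N ∧ (N : ZMod q) = i ∧ relPow R N x y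

theorem ModPath.trans {q : ℕ} {i j : ZMod q} {x y z : W} (h₁ : ModPath R q i x y)
    (h₂ : ModPath R q j y z) : ModPath R q (i + j) x z := by
  obtain ⟨a, ha, rfl, hxy⟩ := h₁
  obtain ⟨b, _, rfl, hyz⟩ := h₂
  exact ⟨a + b, by omega, by push_cast; rfl, relPow_add hxy hyz⟩

theorem ModPath.of_rel {q : ℕ} {x y : W} (h : R x y) : ModPath R q 1 x y :=
  ⟨1, le_rfl, by simp, relPow_one.2 h⟩

theorem ModPath.reflTransGen {q : ℕ} {i : ZMod q} {x y : W} (h : ModPath R q i x y) :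
    Relation.ReflTransGen R x y :=
  let ⟨_, _, _, h⟩ := h
  reflTransGen_of_relPow h

/-- Going round the closed walk through `x` and `y` the right number of times before returning
corrects the residue. -/
theorem ModPath.reverse {q : ℕ} (hq : 1 ≤ q) {i : ZMod q} {x y : W} (h : ModPath R q i x y)
    (hyx : Relation.ReflTransGen R y x) : ModPath R q (-i) y x := by
  obtain ⟨N, hN, rfl, hxy⟩ := h
  obtain ⟨r, hr⟩ := exists_relPow hyx
  -- `2 * q - 1` is `-1` modulo `q` and, unlike `q - 1`, positive even for `q = 1`, so the path is
  -- nonempty.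
  refine ⟨(2 * q - 1) * (r + N) + r, ?_, ?_, relPow_add (relPow_mul_self (relPow_add hr hxy) _) hr⟩
  · have : 0 < (2 * q - 1) * (r + N) := Nat.mul_pos (by omega) (by omega)
    omega
  · rw [Nat.cast_add, Nat.cast_mul, Nat.cast_sub (by omega)]
    push_cast
    rw [ZMod.natCast_self]
    ring

/-- A rank function with values below `h`: it does not increase along `R`, and an edge along which
it is constant lies inside a cluster. -/
structure IsRank (R : W → W → Prop) (h : ℕ) (d : W → ℕ) : Prop where
  lt : ∀ x, d x < h
  le : ∀ x y, R x y → d y ≤ d x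
  back : ∀ x y, R x y → d x = d y → Relation.ReflTransGen R y x

theorem IsRank.le_of_reflTransGen {h : ℕ} {d : W → ℕ} (hd : IsRank R h d) {x y : W}
    (hxy : Relation.ReflTransGen R x y) : d y ≤ d x := by
  induction hxy with
  | refl => exact le_rfl
  | tail _ h ih => exact (hd.le _ _ h).trans ih

theorem IsRank.back_of_reflTransGen {h : ℕ} {d : W → ℕ} (hd : IsRank R h d) {x y : W}
    (hxy : Relation.ReflTransGen R x y) (he : d x = d y) : Relation.ReflTransGen R y x := by
  induction hxy with
  | refl => exact .refl
  | tail hxz hzy ih =>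
    have h₁ := hd.le_of_reflTransGen hxz
    have h₂ := hd.le _ _ hzy
    exact (hd.back _ _ hzy (by omega)).trans (ih (by omega))

/-- In a frame of finite height, every finite colouring has a finite refinement that is tuned for
the relation "there is a path whose length is `1` modulo `q`". -/
theorem exists_tuned_refinement {q h : ℕ} (hq : 1 ≤ q) {d : W → ℕ} (hd : IsRank R h d)
    {T : Type u} [Finite T] (c : W → T) (hc : ∀ x y, c x = c y → d x = d y) (k : ℕ) :
    ∃ (V : Type u) (_ : Finite V) (f : W → V), (∀ x y, f x = f y → c x = c y) ∧
      ∀ x x' y, d x < k → f x = f x' → ModPath R q 1 x y →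
        ∃ y', ModPath R q 1 x' y' ∧ f y = f y' := by
  classical
  have : NeZero q := ⟨by omega⟩
  induction k with
  | zero => exact ⟨T, ‹_›, c, fun _ _ => id, fun x x' y hx => absurd hx (Nat.not_lt_zero _)⟩
  | succ k ih =>
    obtain ⟨V, _, f, hfc, hf⟩ := ih
    have hfd : ∀ x y, f x = f y → d x = d y := fun x y hxy => hc x y (hfc x y hxy)
    let below : W → Set V := fun x => {v | ∃ z, ModPath R q 1 x z ∧ d z < k ∧ f z = v}
    let g : W → V × Set V := fun x => (f x, below x)
    -- All residues are recorded, not just `1`, so that a step inside a cluster merely shifts this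
    -- data (`hshift`).
    let inside : W → ZMod q → Set (V × Set V) :=
      fun x i => {v | ∃ z, ModPath R q i x z ∧ d z = k ∧ g z = v}
    -- The constant default off rank `k` leaves the partition of those points unchanged.
    let f' : W → V × Set V × (ZMod q → Set (V × Set V)) :=
      fun x => (f x, if d x = k then (below x, inside x) else (∅, fun _ => ∅))
    have hf'_ne : ∀ x y, f x = f y → d x ≠ k → f' x = f' y := by
      intro x y hxy hx
      have hy : d y ≠ k := hfd x y hxy ▸ hx
      simp only [f', if_neg hx, if_neg hy, hxy]
    have hshift : ∀ x y, ModPath R q 1 x y → d x = d y → ∀ i, inside y i = inside x (1 + i) := by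
      intro x y hxy he i
      ext v
      constructor
      · rintro ⟨z, hz, hzk, rfl⟩
        exact ⟨z, hxy.trans hz, hzk, rfl⟩
      · rintro ⟨z, hz, hzk, rfl⟩
        have := (hxy.reverse hq (hd.back_of_reflTransGen hxy.reflTransGen he)).trans hz
        rw [neg_add_cancel_left] at this
        exact ⟨z, this, hzk, rfl⟩
    refine ⟨_, inferInstance, f', fun x y hxy => hfc x y (congrArg Prod.fst hxy), ?_⟩
    intro x x' y hx hxx' hxy
    have hfx : f x = f x' := congrArg Prod.fst hxx'
    have hle := hd.le_of_reflTransGen hxy.reflTransGen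
    rcases Nat.lt_succ_iff_lt_or_eq.1 hx with hlt | heq
    · obtain ⟨y', hy', hfy⟩ := hf x x' y hlt hfx hxy
      exact ⟨y', hy', hf'_ne _ _ hfy (by omega)⟩
    · have heq' : d x' = k := hfd x x' hfx ▸ heq
      have hdata := congrArg Prod.snd hxx'
      simp only [f', if_pos heq, if_pos heq'] at hdata
      have hbelow : below x = below x' := congrArg Prod.fst hdata
      have hinside : inside x = inside x' := congrArg Prod.snd hdata
      rcases (hle.trans heq.le).lt_or_eq with hy | hy
      · have hmem : f y ∈ below x' := hbelow ▸ ⟨y, hxy, hy, rfl⟩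
        obtain ⟨z, hz, hzk, hfz⟩ := hmem
        exact ⟨z, hz, hf'_ne _ _ hfz.symm hy.ne⟩
      -- Here `y` stays in the cluster of `x`. Matching `g` gives the first two components of `f'`;
      -- the third agrees because it is a shift of `inside x = inside x'`.
      · have hmem : g y ∈ inside x' 1 := hinside ▸ ⟨y, hxy, hy, rfl⟩
        obtain ⟨z, hz, hzk, hgz⟩ := hmem
        refine ⟨z, hz, ?_⟩
        have h₁ : f z = f y := congrArg Prod.fst hgz
        have h₂ : below z = below y := congrArg Prod.snd hgz
        have h₃ : inside y = inside z := by
          funext i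
          rw [hshift x y hxy (heq.trans hy.symm), hshift x' z hz (heq'.trans hzk.symm), hinside]
        simp only [f', if_pos hy, if_pos hzk, h₁, h₂, h₃]

end Relations

/-! ### Height, and preservation of the frame classes under filtration. -/

namespace KFrame

/-- The rank descends to the skeleton and is injective on chains, so no chain has more than `h`
elements. -/
theorem exists_hasHeight_of_isRank {F : KFrame.{u}} {h : ℕ} {d : F.W → ℕ} (hd : IsRank F.R h d) :
    ∃ k ≤ h, F.HasHeight k := by
  classical
  let e : F.Skeleton → ℕ := Quotient.lift d fun x y hxy =>
    le_antisymm (hd.le_of_reflTransGen hxy.2) (hd.le_of_reflTransGen hxy.1)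
  have hinj : ∀ a b : F.Skeleton, a ≤ b → e a = e b → a = b := by
    rintro ⟨x⟩ ⟨y⟩ hxy he
    exact Quotient.sound ⟨hxy, hd.back_of_reflTransGen hxy he⟩
  have hle : ∀ c : Set F.Skeleton, IsChain (· ≤ ·) c → c.encard ≤ h := by
    intro c hc
    have hinjOn : Set.InjOn e c := by
      intro a ha b hb hab
      rcases hc.total ha hb with hle | hle
      · exact hinj a b hle hab
      · exact (hinj b a hle hab.symm).symm
    rw [← hinjOn.encard_image]
    have hsub : e '' c ⊆ (Finset.range h : Set ℕ) := by
      rintro _ ⟨⟨x⟩, -, rfl⟩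
      exact Finset.mem_coe.2 (Finset.mem_range.2 (hd.lt x))
    refine (Set.encard_le_encard hsub).trans ?_
    rw [Set.encard_coe_eq_coe_finsetCard, Finset.card_range]
  let P : ℕ → Prop := fun k => ∃ c : Set F.Skeleton, IsChain (· ≤ ·) c ∧ c.encard = k
  have hP : P 0 := ⟨∅, Set.pairwise_empty _, by simp⟩
  refine ⟨Nat.findGreatest P h, Nat.findGreatest_le h,
    Nat.findGreatest_spec (P := P) (Nat.zero_le h) hP, fun c hc => ?_⟩
  obtain ⟨k, hk⟩ := ENat.ne_top_iff_exists.1 (ne_top_of_le_ne_top (ENat.natCast_ne_top h) (hle c hc))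
  have hkh : k ≤ h := by
    have := hle c hc
    rw [← hk] at this
    exact_mod_cast this
  rw [← hk]
  exact_mod_cast Nat.le_findGreatest hkh (⟨c, hc, hk.symm⟩ : P k)

/-- The rank is the coheight of the cluster, finite because chains are bounded. -/
theorem HasHeight.exists_isRank {F : KFrame.{u}} {h : ℕ} (hF : F.HasHeight h) :
    ∃ d : F.W → ℕ, IsRank F.R h d := by
  let cl : F.W → F.Skeleton := Quotient.mk F.clusterSetoid
  have hlt : ∀ a : F.Skeleton, Order.coheight a < h := by
    intro a
    by_contra! hcon
    obtain ⟨p, -, hp⟩ := Order.exists_series_of_le_coheight a hcon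
    have hch := hF.2 (Set.range p) p.monotone.isChain_range
    rw [← Set.image_univ, p.strictMono.injective.encard_image, Set.encard_univ,
      ENat.card_eq_coe_fintype_card, Fintype.card_fin, hp] at hch
    have : h + 1 ≤ h := by exact_mod_cast hch
    omega
  have hfin : ∀ a : F.Skeleton, ((Order.coheight a).toNat : ℕ∞) = Order.coheight a :=
    fun a => ENat.natCast_toNat (ne_top_of_lt (hlt a))
  have hmono : ∀ a b : F.Skeleton, a ≤ b → (Order.coheight b).toNat ≤ (Order.coheight a).toNat :=
    fun a b hab => ENat.toNat_le_toNat (Order.coheight_anti hab) (ne_top_of_lt (hlt a))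
  refine ⟨fun x => (Order.coheight (cl x)).toNat, ?_, ?_, ?_⟩
  · intro x
    have := hlt (cl x)
    rw [← hfin] at this
    exact_mod_cast this
  · exact fun x y hxy => hmono (cl x) (cl y) (Relation.ReflTransGen.single hxy)
  · intro x y hxy he
    have hle : cl x ≤ cl y := Relation.ReflTransGen.single hxy
    by_contra hcon
    have hlt' : cl x < cl y := lt_of_le_not_ge hle hcon
    have := Order.coheight_strictAnti hlt' ((hlt _).trans (ENat.natCast_lt_top h))
    rw [← hfin, ← hfin (cl x), he] at this
    exact lt_irrefl _ this

/-- The minimal filtration of a frame through a map. -/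
def filtration (F : KFrame.{u}) {V : Type u} (f : F.W → V) : KFrame.{u} where
  W := Set.range f
  nonempty := F.nonempty.map (Set.rangeFactorization f)
  R a b := ∃ x y, f x = a ∧ f y = b ∧ F.R x y

theorem isRank_filtration {F : KFrame.{u}} {V : Type u} {f : F.W → V} {h : ℕ} {d : F.W → ℕ}
    (hd : IsRank F.R h d) (hf : ∀ x y, f x = f y → d x = d y) :
    ∃ e, IsRank (F.filtration f).R h e := by
  have hmk : ∀ a : Set.range f, f a.2.choose = a := fun a => a.2.choose_spec
  refine ⟨fun a => d a.2.choose, fun a => hd.lt _, ?_, ?_⟩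
  · rintro a b ⟨x, y, hx, hy, hxy⟩
    rw [hf _ x ((hmk a).trans hx.symm), hf _ y ((hmk b).trans hy.symm)]
    exact hd.le _ _ hxy
  · rintro a b ⟨x, y, hx, hy, hxy⟩ he
    rw [hf _ x ((hmk a).trans hx.symm), hf _ y ((hmk b).trans hy.symm)] at he
    have : Relation.ReflTransGen (F.filtration f).R (Set.rangeFactorization f y)
        (Set.rangeFactorization f x) :=
      (hd.back _ _ hxy he).lift (Set.rangeFactorization f) fun u v huv => ⟨u, v, rfl, rfl, huv⟩
    rwa [show Set.rangeFactorization f x = a from Subtype.ext hx,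
      show Set.rangeFactorization f y = b from Subtype.ext hy] at this

/-- Paths in a filtration through a tuned map lift to paths of the same length modulo `q`. -/
theorem exists_relPow_of_filtration {F : KFrame.{u}} {V : Type u} {f : F.W → V} {q : ℕ}
    (hf : ∀ x x' y, f x = f x' → ModPath F.R q 1 x y → ∃ y', ModPath F.R q 1 x' y' ∧ f y = f y')
    {l : ℕ} {a b : Set.range f} (hab : relPow (F.filtration f).R l a b) :
    ∃ x y N, f x = a ∧ f y = b ∧ l ≤ N ∧ (N : ZMod q) = l ∧ relPow F.R N x y := by
  induction l generalizing b with
  | zero =>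
    obtain rfl : a = b := hab
    obtain ⟨x, hx⟩ := a.2
    exact ⟨x, x, 0, hx, hx, le_rfl, rfl, rfl⟩
  | succ l ih =>
    obtain ⟨c, hac, y, z, hy, hz, hyz⟩ := hab
    obtain ⟨x, w, N, hx, hw, hN, hNl, hxw⟩ := ih hac
    obtain ⟨z', ⟨M, hM, hM', hwz⟩, hzz'⟩ :=
      -- The lift ends at `w`, the next edge starts at `y`, in the same class; tuning moves that
      -- edge to `w` as a path of length `M ≥ 1`.
      hf y w z (hy.trans hw.symm) (ModPath.of_rel hyz)
    exact ⟨x, z', N + M, hx, hzz'.symm.trans hz, by omega, by push_cast; rw [hNl, hM'],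
      relPow_add hxw hwz⟩

theorem relPow_filtration {F : KFrame.{u}} {V : Type u} {f : F.W → V} {l : ℕ} {x y : F.W}
    {a b : Set.range f} (hx : f x = a) (hy : f y = b) (hxy : relPow F.R l x y) :
    relPow (F.filtration f).R l a b := by
  have := relPow_map (Q := (F.filtration f).R) (Set.rangeFactorization f)
    (fun u v huv => ⟨u, v, rfl, rfl, huv⟩) hxy
  rwa [show Set.rangeFactorization f x = a from Subtype.ext hx,
    show Set.rangeFactorization f y = b from Subtype.ext hy] at this

theorem IsMN.filtration {F : KFrame.{u}} {m n : ℕ} (hF : F.IsMN m n) (hmn : m < n) {V : Type u}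
    {f : F.W → V}
    (hf : ∀ x x' y, f x = f x' → ModPath F.R (n - m) 1 x y →
      ∃ y', ModPath F.R (n - m) 1 x' y' ∧ f y = f y') :
    (F.filtration f).IsMN m n := by
  intro a b hab
  obtain ⟨x, y, N, hx, hy, hN, hNn, hxy⟩ := exists_relPow_of_filtration hf hab
  refine relPow_filtration hx hy ?_
  obtain ⟨t, ht⟩ := (Nat.modEq_iff_dvd' hN).1 ((ZMod.natCast_eq_natCast_iff _ _ _).1 hNn).symm
  have hNt : N = m + (t + 1) * (n - m) := by
    rw [Nat.succ_mul, Nat.mul_comm]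
    omega
  refine relPow_reduce (q := n - m) (fun u v huv => hF u v ?_) (t + 1) (hNt ▸ hxy)
  rwa [Nat.add_sub_cancel' hmn.le] at huv

theorem IsMTransitive.filtration {F : KFrame.{u}} {m : ℕ} (hF : F.IsMTransitive m) {V : Type u}
    {f : F.W → V}
    (hf : ∀ x x' y, f x = f x' → ModPath F.R 1 1 x y → ∃ y', ModPath F.R 1 1 x' y' ∧ f y = f y') :
    (F.filtration f).IsMTransitive m := by
  intro a b
  constructor
  · intro hab
    obtain ⟨l, hl⟩ := exists_relPow hab
    obtain ⟨x, y, N, hx, hy, -, -, hxy⟩ := exists_relPow_of_filtration hf hl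
    obtain ⟨i, him, hi⟩ := (hF x y).1 (reflTransGen_of_relPow hxy)
    exact ⟨i, him, relPow_filtration hx hy hi⟩
  · rintro ⟨i, -, hi⟩
    exact reflTransGen_of_relPow hi

theorem exists_tuned_of_hasHeight {F : KFrame.{u}} {k q : ℕ} (hF : F.HasHeight k) (hq : 1 ≤ q)
    {T : Type u} [Finite T] (c : F.W → T) :
    ∃ (V : Type u) (_ : Finite V) (f : F.W → V), (∀ x y, f x = f y → c x = c y) ∧
      (∀ x x' y, f x = f x' → ModPath F.R q 1 x y →
        ∃ y', ModPath F.R q 1 x' y' ∧ f y = f y') ∧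
      ∃ l ≤ k, (F.filtration f).HasHeight l := by
  obtain ⟨d, hd⟩ := hF.exists_isRank
  obtain ⟨V, hV, f, hfc, hf⟩ := exists_tuned_refinement hq hd
    -- Adding the rank to the colour makes it descend to the filtration, which bounds the height.
    (fun x => (c x, (⟨d x, hd.lt x⟩ : Fin k))) (fun x y hxy => congrArg (fun p => p.2.val) hxy) k
  obtain ⟨e, he⟩ := isRank_filtration (f := f) hd
    fun x y hxy => congrArg (fun p => p.2.val) (hfc x y hxy)
  exact ⟨V, hV, f, fun x y hxy => congrArg Prod.fst (hfc x y hxy),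
    fun x x' y => hf x x' y (hd.lt x), exists_hasHeight_of_isRank he⟩

end KFrame

/-! ### Truth lemma and the finite model property. -/

/-- The truth lemma for minimal filtrations through sufficiently fine maps. -/
theorem exists_coloring {k : ℕ} (F : MultiFrame.{u} k) (θ : ℕ → Set F.W) (φ : Formula k) :
    ∃ (T : Type u) (_ : Finite T) (c : F.W → T), ∀ (G : MultiFrame.{u} k) (f : F.W → G.W),
      (∀ x y, f x = f y → c x = c y) →
      (∀ i a b, G.R i a b ↔ ∃ x y, f x = a ∧ f y = b ∧ F.R i x y) →
      ∀ x, F.Sat θ x φ ↔ G.Sat (fun p => f '' θ p) (f x) φ := by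
  have pair : ∀ {α β γ : Formula k}, (∀ (G : MultiFrame.{u} k) (η : ℕ → Set G.W) (f : F.W → G.W) x,
      (F.Sat θ x α ↔ G.Sat η (f x) α) → (F.Sat θ x β ↔ G.Sat η (f x) β) →
      (F.Sat θ x γ ↔ G.Sat η (f x) γ)) →
      (∃ (T : Type u) (_ : Finite T) (c : F.W → T), ∀ (G : MultiFrame.{u} k) (f : F.W → G.W),
        (∀ x y, f x = f y → c x = c y) →
        (∀ i a b, G.R i a b ↔ ∃ x y, f x = a ∧ f y = b ∧ F.R i x y) →
        ∀ x, F.Sat θ x α ↔ G.Sat (fun p => f '' θ p) (f x) α) →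
      (∃ (T : Type u) (_ : Finite T) (c : F.W → T), ∀ (G : MultiFrame.{u} k) (f : F.W → G.W),
        (∀ x y, f x = f y → c x = c y) →
        (∀ i a b, G.R i a b ↔ ∃ x y, f x = a ∧ f y = b ∧ F.R i x y) →
        ∀ x, F.Sat θ x β ↔ G.Sat (fun p => f '' θ p) (f x) β) →
      (∃ (T : Type u) (_ : Finite T) (c : F.W → T), ∀ (G : MultiFrame.{u} k) (f : F.W → G.W),
        (∀ x y, f x = f y → c x = c y) →
        (∀ i a b, G.R i a b ↔ ∃ x y, f x = a ∧ f y = b ∧ F.R i x y) →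
        ∀ x, F.Sat θ x γ ↔ G.Sat (fun p => f '' θ p) (f x) γ) := by
    rintro α β γ hγ ⟨T, _, c, hc⟩ ⟨T', _, c', hc'⟩
    exact ⟨T × T', inferInstance, fun x => (c x, c' x), fun G f hf hR x => hγ G _ f x
      (hc G f (fun x y h => congrArg Prod.fst (hf x y h)) hR x)
      (hc' G f (fun x y h => congrArg Prod.snd (hf x y h)) hR x)⟩
  have const : ∀ {γ : Formula k}, (∀ (G : MultiFrame.{u} k) (η : ℕ → Set G.W) (f : F.W → G.W) x,
      (F.Sat θ x γ ↔ G.Sat η (f x) γ)) →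
      (∃ (T : Type u) (_ : Finite T) (c : F.W → T), ∀ (G : MultiFrame.{u} k) (f : F.W → G.W),
        (∀ x y, f x = f y → c x = c y) →
        (∀ i a b, G.R i a b ↔ ∃ x y, f x = a ∧ f y = b ∧ F.R i x y) →
        ∀ x, F.Sat θ x γ ↔ G.Sat (fun p => f '' θ p) (f x) γ) :=
    fun hγ => ⟨PUnit, inferInstance, fun _ => ⟨⟩, fun G f _ _ x => hγ G _ f x⟩
  induction φ with
  | var p =>
    refine ⟨ULift Prop, inferInstance, fun x => ⟨x ∈ θ p⟩, fun G f hf _ x => ?_⟩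
    refine ⟨fun h => Set.mem_image_of_mem f h, ?_⟩
    rintro ⟨y, hy, hyx⟩
    exact (congrArg ULift.down (hf y x hyx)).mp hy
  | bot => exact const fun _ _ _ _ => Iff.rfl
  | top => exact const fun _ _ _ _ => Iff.rfl
  | and α β ihα ihβ => exact pair (fun _ _ _ _ h₁ h₂ => and_congr h₁ h₂) ihα ihβ
  | or α β ihα ihβ => exact pair (fun _ _ _ _ h₁ h₂ => or_congr h₁ h₂) ihα ihβ
  | neg α ih => exact pair (fun _ _ _ _ h _ => not_congr h) ih ih
  | imp α β ihα ihβ => exact pair (fun _ _ _ _ h₁ h₂ => imp_congr h₁ h₂) ihα ihβ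
  | iff α β ihα ihβ => exact pair (fun _ _ _ _ h₁ h₂ => iff_congr h₁ h₂) ihα ihβ
  | dia i α ih =>
    obtain ⟨T, _, c, hc⟩ := ih
    -- An edge of `G` out of `f x` may come from another preimage `x'`; the extra bit carries the
    -- diamond back to `x`.
    refine ⟨T × ULift Prop, inferInstance, fun x => (c x, ⟨F.Sat θ x (.dia i α)⟩),
      fun G f hf hR x => ?_⟩
    have ih := hc G f (fun x y h => congrArg Prod.fst (hf x y h)) hR
    constructor
    · rintro ⟨y, hxy, hy⟩
      exact ⟨f y, (hR _ _ _).2 ⟨x, y, rfl, rfl, hxy⟩, (ih y).1 hy⟩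
    · rintro ⟨b, hxb, hb⟩
      obtain ⟨x', y, hx', rfl, hxy⟩ := (hR _ _ _).1 hxb
      exact (congrArg (fun p => p.2.down) (hf x' x hx')).mp ⟨y, hxy, (ih y).2 hb⟩

/-- The frame obtained by relabelling the points along a bijection. -/
def MultiFrame.relabel {k : ℕ} (G : MultiFrame.{u} k) {V : Type} (e : V ≃ G.W) :
    MultiFrame.{0} k where
  W := V
  nonempty := G.nonempty.map e.symm
  R i a b := G.R i (e a) (e b)

theorem MultiFrame.sat_relabel {k : ℕ} (G : MultiFrame.{u} k) {V : Type} (e : V ≃ G.W)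
    (θ : ℕ → Set G.W) (φ : Formula k) (a : V) :
    (G.relabel e).Sat (fun p => e ⁻¹' θ p) a φ ↔ G.Sat θ (e a) φ := by
  induction φ generalizing a with
  | var p => exact Iff.rfl
  | bot => exact Iff.rfl
  | top => exact Iff.rfl
  | and α β ihα ihβ => exact and_congr (ihα a) (ihβ a)
  | or α β ihα ihβ => exact or_congr (ihα a) (ihβ a)
  | neg α ih => exact not_congr (ih a)
  | imp α β ihα ihβ => exact imp_congr (ihα a) (ihβ a)
  | iff α β ihα ihβ => exact iff_congr (ihα a) (ihβ a)
  | dia i α ih =>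
    constructor
    · rintro ⟨b, hab, hb⟩
      exact ⟨e b, hab, (ih b).1 hb⟩
    · rintro ⟨b, hab, hb⟩
      obtain ⟨b, rfl⟩ := e.surjective b
      exact ⟨b, hab, (ih b).2 hb⟩

theorem MultiFrame.valid_relabel {k : ℕ} (G : MultiFrame.{u} k) {V : Type} (e : V ≃ G.W)
    (φ : Formula k) : (G.relabel e).Valid φ ↔ G.Valid φ := by
  constructor
  · intro h θ w
    obtain ⟨a, rfl⟩ := e.surjective w
    exact (G.sat_relabel e θ φ a).1 (h _ a)
  · intro h θ a
    have hθ : (fun p => e ⁻¹' (e.symm ⁻¹' θ p)) = θ :=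
      funext fun p => e.preimage_symm_preimage (θ p)
    exact hθ ▸ (G.sat_relabel e (fun p => e.symm ⁻¹' θ p) φ a).2 (h _ _)

/-- If a class of frames admits finite minimal filtrations through arbitrarily fine maps, then its
tense logic has the finite model property. -/
theorem hasFMP_tense_of_filtration {C : Set KFrame.{u}}
    (hC : ∀ F ∈ C, ∀ (T : Type u) [Finite T] (c : F.W → T),
      ∃ (V : Type u) (_ : Finite V) (f : F.W → V), (∀ x y, f x = f y → c x = c y) ∧
        F.filtration f ∈ C) :
    HasFMP (Log (tenseClass C)) := by
  refine ⟨{G | Finite G.W ∧ ∀ φ ∈ Log (tenseClass C), G.Valid φ}, fun G hG => hG.1,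
    Set.Subset.antisymm (fun φ hφ G hG => hG.2 φ hφ) ?_⟩
  rintro φ hφ _ ⟨F, hF, rfl⟩ θ w
  obtain ⟨T, _, c, hc⟩ := exists_coloring F.tense θ φ
  obtain ⟨V, _, f, hfc, hfC⟩ := hC F hF T c
  have hfin : Finite (F.filtration f).tense.W := inferInstanceAs (Finite (Set.range f))
  -- Relabelling by `Fin N` brings the finite frame down to universe `0`.
  obtain ⟨N, ⟨e⟩⟩ := Finite.exists_equiv_fin (F.filtration f).tense.W
  have hvalid : ((F.filtration f).tense.relabel e.symm).Valid φ :=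
    hφ _ ⟨inferInstanceAs (Finite (Fin N)), fun ψ hψ =>
      (MultiFrame.valid_relabel _ _ ψ).2 (hψ _ ⟨_, hfC, rfl⟩)⟩
  refine (hc (F.filtration f).tense (Set.rangeFactorization f)
    (fun x y h => hfc x y (congrArg Subtype.val h)) ?_ w).2
    ((MultiFrame.valid_relabel _ _ φ).1 hvalid _ _)
  intro i a b
  fin_cases i
  · exact ⟨fun ⟨x, y, hx, hy, h⟩ => ⟨x, y, Subtype.ext hx, Subtype.ext hy, h⟩,
      fun ⟨x, y, hx, hy, h⟩ => ⟨x, y, congrArg Subtype.val hx, congrArg Subtype.val hy, h⟩⟩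
  · exact ⟨fun ⟨x, y, hx, hy, h⟩ => ⟨y, x, Subtype.ext hy, Subtype.ext hx, h⟩,
      fun ⟨x, y, hx, hy, h⟩ => ⟨y, x, congrArg Subtype.val hy, congrArg Subtype.val hx, h⟩⟩

end KModal

theorem mainTheorem11 (m n h : ℕ) (hm : 1 ≤ m) (hmn : m < n) (hh : 1 ≤ h) :
    KModal.HasFMP (KModal.Log (KModal.tenseClass (KModal.classF.{u} m n h))) ∧
    KModal.HasFMP (KModal.Log (KModal.tenseClass (KModal.classFStar.{u} m n))) ∧
    KModal.HasFMP (KModal.Log (KModal.tenseClass (KModal.classG.{u} m h))) ∧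
    KModal.HasFMP (KModal.Log (KModal.tenseClass (KModal.classGStar.{u} m))) := by
  have hq : 1 ≤ n - m := by omega
  refine ⟨KModal.hasFMP_tense_of_filtration ?_, KModal.hasFMP_tense_of_filtration ?_,
    KModal.hasFMP_tense_of_filtration ?_, KModal.hasFMP_tense_of_filtration ?_⟩
  · rintro F ⟨hF, k, hk, hFk⟩ T _ c
    obtain ⟨V, hV, f, hfc, hf, l, hl, hfl⟩ := KModal.KFrame.exists_tuned_of_hasHeight hFk hq c
    exact ⟨V, hV, f, hfc, hF.filtration hmn hf, l, hl.trans hk, hfl⟩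
  · rintro F ⟨hF, k, hFk⟩ T _ c
    obtain ⟨V, hV, f, hfc, hf, l, -, hfl⟩ := KModal.KFrame.exists_tuned_of_hasHeight hFk hq c
    exact ⟨V, hV, f, hfc, hF.filtration hmn hf, l, hfl⟩
  · rintro F ⟨hF, k, hk, hFk⟩ T _ c
    obtain ⟨V, hV, f, hfc, hf, l, hl, hfl⟩ := KModal.KFrame.exists_tuned_of_hasHeight hFk le_rfl c
    exact ⟨V, hV, f, hfc, hF.filtration hf, l, hl.trans hk, hfl⟩
  · rintro F ⟨hF, k, hFk⟩ T _ c
    obtain ⟨V, hV, f, hfc, hf, l, -, hfl⟩ := KModal.KFrame.exists_tuned_of_hasHeight hFk le_rfl c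
    exact ⟨V, hV, f, hfc, hF.filtration hf, l, hfl⟩
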